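/- Let $M,N\in\mathbb N$ and $0\le\alpha_1<\alpha_2<\dots<\alpha_{MN}<N$. A Hilbert--Schmidt operator $H$ on $L^2(\mathbb R)$ is a bounded operator of the form $Hf(x)=\int\kappa_H(x,t)f(t)\,dt$ with $\kappa_H\in L^2(\mathbb R^2)$; put $\|H\|_{HS}=\|\kappa_H\|_{L^2(\mathbb R^2)}$. Its Kohn--Nirenberg symbol is $\sigma_H(x,\xi)=\int\kappa_H(x,x-t)e^{-2\pi i t\xi}\,dt$, and its spreading function is the symplectic Fourier transform $$\eta_H(t,\nu)=\mathcal F_s\sigma_H(t,\nu)=\iint\sigma_H(x,\xi)e^{-2\pi i(\nu x-\xi t)}\,dx\,d\xi$$ (both integrals in the $L^2$ sense). For closed $S\subseteq\mathbb R^2$ let $OPW(S)$ be the set of Hilbert--Schmidt operators $H$ with $\operatorname{supp}\mathcal F_s\sigma_H\subseteq S$. For a tempered distribution $f$ and $H\in OPW(S)$ with $S$ compact, $Hf$ is defined weakly by $$\langle Hf,g\rangle=\iint\eta_H(t,\nu)\,\langle M_\nu T_tf,g\rangle\,dt\,d\nu\qquad(g\in\mathcal S(\mathbb R)),$$ where $T_tf(x)=f(x-t)$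 and $M_\nu f(x)=e^{2\pi i\nu x}f(x)$. Then, for each $j$, the series $\sum_{n\in\mathbb Z}\delta_{nN+\alpha_j}$ converges in $\mathcal S'(\mathbb R)$, and there are constants $c,C>0$ (depending only on $M$, $N$ and $\alpha_1,\dots,\alpha_{MN}$) such that for every $H\in OPW\big([0,N]\times[-\tfrac M2,\tfrac M2]\big)$ each $H\big(\sum_{n\in\mathbb Z}\delta_{nN+\alpha_j}\big)$ belongs to $L^2(\mathbb R)$ and $$c\,\|H\|_{HS}^2\le\sum_{j=1}^{MN}\Big\|H\Big(\sum_{n\in\mathbb Z}\delta_{nN+\alpha_j}\Big)\Big\|_{L^2(\mathbb R)}^2\le C\,\|H\|_{HS}^2 .$$ -/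

import Mathlib

open MeasureTheory FourierTransform SchwartzMap

namespace OperatorSampling

noncomputable section

/-! ### The `L²` Fourier transform in one of two variables -/

/-- The complex Hilbert space `L²(X)` of a measure space. -/
abbrev L2 (X : Type*) [MeasureSpace X] := Lp ℂ 2 (volume : Measure X)

/-- The shear `(x, t) ↦ (x, x - t)` preserves Lebesgue measure. -/
theorem measurePreserving_shear :
    MeasurePreserving (fun z : ℝ × ℝ => (z.1, z.1 - z.2)) volume volume := by
  have h1 := measurePreserving_prod_sub (volume : Measure ℝ) (volume : Measure ℝ)
  have h2 := (MeasurePreserving.id (volume : Measure ℝ)).prod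
    (Measure.measurePreserving_neg (volume : Measure ℝ))
  convert! h2.comp h1 using 2 with z
  simp

/-- The integral Fourier transform and the `L²` Fourier transform agree on `L¹ ∩ L²`. -/
theorem fourier_L2_ae_eq (f : ℝ → ℂ) (h1 : Integrable f) (h2 : MemLp f 2 volume) :
    ((𝓕 (h2.toLp f) : L2 ℝ) : ℝ → ℂ) =ᵐ[volume] 𝓕 f := by
  have hc : Continuous (𝓕 f) := VectorFourier.fourierIntegral_continuous (L := innerₗ ℝ)
    Real.continuous_fourierChar continuous_inner h1
  apply ae_eq_of_integral_contDiff_smul_eq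
  · exact (Lp.memLp _).locallyIntegrable (by norm_num)
  · exact hc.locallyIntegrable
  · intro g gs gc
    have hg₁ : HasCompactSupport (Complex.ofRealCLM ∘ g) := gc.comp_left rfl
    have hg₂ : ContDiff ℝ (⊤ : ℕ∞) (Complex.ofRealCLM ∘ g) := by fun_prop
    set G : 𝓢(ℝ, ℂ) := hg₁.toSchwartzMap hg₂ with hG
    have e := congrArg (fun T : 𝓢'(ℝ, ℂ) => T G)
      (Lp.fourier_toTemperedDistribution_eq (h2.toLp f))
    simp only [TemperedDistribution.fourier_apply, Lp.toTemperedDistribution_apply] at e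
    have e1 : ∫ x, g x • (𝓕 (h2.toLp f) : L2 ℝ) x = ∫ x, G x • (𝓕 (h2.toLp f) : L2 ℝ) x := by
      simp [hG]
    have e2 : ∫ x, g x • (𝓕 f) x = ∫ x, (𝓕 f) x • G x := by
      congr 1; ext x; simp [hG, mul_comm]
    have e3 : ∫ x, (𝓕 G) x • (h2.toLp f) x = ∫ x, f x • (𝓕 G) x := by
      apply integral_congr_ae
      filter_upwards [h2.coeFn_toLp] with x hx
      rw [hx]; simp [mul_comm]
    rw [e1, ← e, e3, e2]
    have := VectorFourier.integral_fourierIntegral_smul_eq_flip (L := innerₗ ℝ)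
      (e := Real.fourierChar) (μ := volume) (ν := volume) Real.continuous_fourierChar
      continuous_inner h1 G.integrable
    rw [flip_innerₗ] at this
    exact this.symm

/-- `G` is the Fourier transform of `F` in the second variable: for almost every `x`, the slice
`G (x, ·)` is the `L²` Fourier transform of the slice `F (x, ·)`. -/
def IsPartialFourier (F G : L2 (ℝ × ℝ)) : Prop :=
  ∀ᵐ x : ℝ, ∃ f : L2 ℝ, (f =ᵐ[volume] fun t => F (x, t)) ∧
    ((𝓕 f : L2 ℝ) =ᵐ[volume] fun ξ => G (x, ξ))

theorem enorm_sq_L2 {X : Type*} [MeasureSpace X] (f : L2 X) :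
    ‖f‖ₑ ^ 2 = ∫⁻ t, ‖f t‖ₑ ^ 2 := by
  have := eLpNorm_nnreal_pow_eq_lintegral (f := f) (μ := volume) (p := 2) (by norm_num)
  rw [Lp.enorm_def]
  simpa using this

theorem enorm_sq_L2_prod (F : L2 (ℝ × ℝ)) :
    ‖F‖ₑ ^ 2 = ∫⁻ x, ∫⁻ t, ‖F (x, t)‖ₑ ^ 2 := by
  rw [enorm_sq_L2]
  exact lintegral_prod _ (by
    have := (Lp.stronglyMeasurable F).measurable
    exact (this.enorm.pow_const 2).aemeasurable)

theorem IsPartialFourier.enorm_eq {F G : L2 (ℝ × ℝ)} (h : IsPartialFourier F G) :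
    ‖G‖ₑ ^ 2 = ‖F‖ₑ ^ 2 := by
  rw [enorm_sq_L2_prod, enorm_sq_L2_prod]
  apply lintegral_congr_ae
  filter_upwards [h] with x ⟨f, hf, hg⟩
  have e1 : ∫⁻ t, ‖F (x, t)‖ₑ ^ 2 = ‖f‖ₑ ^ 2 := by
    rw [enorm_sq_L2]
    exact lintegral_congr_ae (by filter_upwards [hf] with t ht; rw [ht])
  have e2 : ∫⁻ t, ‖G (x, t)‖ₑ ^ 2 = ‖(𝓕 f : L2 ℝ)‖ₑ ^ 2 := by
    rw [enorm_sq_L2]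
    exact lintegral_congr_ae (by filter_upwards [hg] with t ht; rw [ht])
  have e3 : ‖(𝓕 f : L2 ℝ)‖ₑ = ‖f‖ₑ := by
    rw [← ofReal_norm, ← ofReal_norm, Lp.norm_fourier_eq]
  show ∫⁻ t, ‖G (x, t)‖ₑ ^ 2 = _
  rw [e1, e2, e3]

theorem coeFn_sub_slices (F F' : L2 (ℝ × ℝ)) :
    ∀ᵐ x : ℝ, ∀ᵐ t : ℝ, (F - F') (x, t) = F (x, t) - F' (x, t) := by
  exact Measure.ae_ae_of_ae_prod (Lp.coeFn_sub F F')

theorem IsPartialFourier.sub {F G F' G' : L2 (ℝ × ℝ)} (h : IsPartialFourier F G)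
    (h' : IsPartialFourier F' G') : IsPartialFourier (F - F') (G - G') := by
  filter_upwards [h, h', coeFn_sub_slices F F', coeFn_sub_slices G G'] with
    x ⟨f, hf, hg⟩ ⟨f', hf', hg'⟩ hF hG
  refine ⟨f - f', ?_, ?_⟩
  · filter_upwards [Lp.coeFn_sub f f', hf, hf', hF] with t h1 h2 h3 h4
    rw [h1, h4, Pi.sub_apply, h2, h3]
  · have : (𝓕 (f - f') : L2 ℝ) = 𝓕 f - 𝓕 f' := (Lp.fourierTransformₗᵢ ℝ ℂ).map_sub f f'
    rw [this]
    filter_upwards [Lp.coeFn_sub (𝓕 f : L2 ℝ) (𝓕 f'), hg, hg', hG] with t h1 h2 h3 h4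
    rw [h1, h4, Pi.sub_apply, h2, h3]

theorem IsPartialFourier.norm_eq {F G : L2 (ℝ × ℝ)} (h : IsPartialFourier F G) :
    ‖G‖ = ‖F‖ := by
  have e := h.enorm_eq
  rw [← ofReal_norm, ← ofReal_norm, ← ENNReal.ofReal_pow (norm_nonneg _),
    ← ENNReal.ofReal_pow (norm_nonneg _),
    ENNReal.ofReal_eq_ofReal_iff (by positivity) (by positivity)] at e
  exact (pow_left_inj₀ (norm_nonneg _) (norm_nonneg _) (by norm_num)).1 e

/-- Functions of compact support have a partial Fourier transform. -/
theorem exists_isPartialFourier_of_continuous (F : L2 (ℝ × ℝ)) (g : ℝ × ℝ → ℂ)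
    (hFg : F =ᵐ[volume] g) (hc : HasCompactSupport g) (hg : Continuous g) :
    ∃ G, IsPartialFourier F G := by
  have hsm : StronglyMeasurable (fun z : ℝ × ℝ => 𝓕 (fun t => g (z.1, t)) z.2) := by
    simp only [Real.fourier_real_eq]
    apply StronglyMeasurable.integral_prod_right'
      (f := fun w : (ℝ × ℝ) × ℝ => Real.fourierChar (-(w.2 * w.1.2)) • g (w.1.1, w.2))
    apply Continuous.stronglyMeasurable
    fun_prop
  have hcs : ∀ x, HasCompactSupport (fun t => g (x, t)) := fun x =>
    HasCompactSupport.of_support_subset_isCompact (K := Prod.snd '' tsupport g)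
      (hc.isCompact.image continuous_snd)
      (fun t ht => ⟨(x, t), subset_tsupport _ ht, rfl⟩)
  have hcont : ∀ x, Continuous (fun t => g (x, t)) := fun x => by fun_prop
  have h2 : ∀ x, MemLp (fun t => g (x, t)) 2 volume := fun x =>
    (hcont x).memLp_of_hasCompactSupport (hcs x)
  have h1 : ∀ x, Integrable (fun t => g (x, t)) := fun x =>
    (hcont x).integrable_of_hasCompactSupport (hcs x)
  have hFg' : ∀ᵐ x : ℝ, ∀ᵐ t : ℝ, F (x, t) = g (x, t) :=
    Measure.ae_ae_of_ae_prod hFg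
  have key : ∀ x, ∫⁻ ξ, ‖𝓕 (fun t => g (x, t)) ξ‖ₑ ^ 2 = ∫⁻ t, ‖g (x, t)‖ₑ ^ 2 := by
    intro x
    have e1 := enorm_sq_L2 ((h2 x).toLp)
    have e2 := enorm_sq_L2 (𝓕 ((h2 x).toLp) : L2 ℝ)
    have e3 : ‖(𝓕 ((h2 x).toLp) : L2 ℝ)‖ₑ = ‖(h2 x).toLp‖ₑ := by
      rw [← ofReal_norm, ← ofReal_norm, Lp.norm_fourier_eq]
    rw [e3, e1] at e2
    rw [lintegral_congr_ae (g := fun ξ => ‖(𝓕 ((h2 x).toLp) : L2 ℝ) ξ‖ₑ ^ 2), ← e2]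
    · exact lintegral_congr_ae (by filter_upwards [(h2 x).coeFn_toLp] with t ht; rw [ht])
    · filter_upwards [fourier_L2_ae_eq _ (h1 x) (h2 x)] with ξ hξ
      rw [hξ]
  have hmem : MemLp (fun z : ℝ × ℝ => 𝓕 (fun t => g (z.1, t)) z.2) 2 volume := by
    refine ⟨hsm.aestronglyMeasurable, ?_⟩
    have := eLpNorm_nnreal_pow_eq_lintegral
      (f := fun z : ℝ × ℝ => 𝓕 (fun t => g (z.1, t)) z.2) (μ := volume) (p := 2) (by norm_num)
    have e : ∫⁻ z : ℝ × ℝ, ‖𝓕 (fun t => g (z.1, t)) z.2‖ₑ ^ 2 = ‖F‖ₑ ^ 2 := by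
      rw [enorm_sq_L2_prod]
      refine (lintegral_prod _ (hsm.measurable.enorm.pow_const 2).aemeasurable).trans ?_
      apply lintegral_congr_ae
      filter_upwards [hFg'] with x hx
      rw [key x]
      exact lintegral_congr_ae (by filter_upwards [hx] with t ht; rw [ht])
    have hlt : ‖F‖ₑ ^ 2 < ⊤ := ENNReal.pow_lt_top enorm_lt_top
    simp only [NNReal.coe_ofNat, ENNReal.coe_ofNat, ENNReal.rpow_ofNat] at this
    rw [← e, ← this] at hlt
    by_contra hcon
    rw [not_lt, top_le_iff] at hcon
    simp [hcon] at hlt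
  refine ⟨hmem.toLp, ?_⟩
  have hG : ∀ᵐ x : ℝ, ∀ᵐ ξ : ℝ, (hmem.toLp : L2 (ℝ × ℝ)) (x, ξ) =
      𝓕 (fun t => g (x, t)) ξ :=
    Measure.ae_ae_of_ae_prod hmem.coeFn_toLp
  filter_upwards [hFg', hG] with x hx hGx
  refine ⟨(h2 x).toLp, ?_, ?_⟩
  · filter_upwards [(h2 x).coeFn_toLp, hx] with t h h'
    rw [h, h']
  · filter_upwards [fourier_L2_ae_eq _ (h1 x) (h2 x), hGx] with ξ h h'
    rw [h, h']

theorem memLp_slices (F : L2 (ℝ × ℝ)) :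
    ∀ᵐ x : ℝ, MemLp (fun t : ℝ => F (x, t)) 2 volume := by
  have hsm := Lp.stronglyMeasurable F
  have h := (memLp_two_iff_integrable_sq_norm hsm.aestronglyMeasurable).1 (Lp.memLp F)
  have h' : ∀ᵐ x : ℝ, Integrable (fun t : ℝ => ‖F (x, t)‖ ^ 2) := Integrable.prod_right_ae h
  filter_upwards [h'] with x hx
  exact (memLp_two_iff_integrable_sq_norm
    (hsm.comp_measurable measurable_prodMk_left).aestronglyMeasurable).2 hx

/-- Partial Fourier transforms pass to limits. -/
theorem IsPartialFourier.of_tendsto {F G : L2 (ℝ × ℝ)} {Fn Gn : ℕ → L2 (ℝ × ℝ)}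
    (h : ∀ n, IsPartialFourier (Fn n) (Gn n))
    (hF : Filter.Tendsto Fn Filter.atTop (nhds F)) (hG : Filter.Tendsto Gn Filter.atTop (nhds G)) :
    IsPartialFourier F G := by
  have hmeas : ∀ A : L2 (ℝ × ℝ), Measurable fun x => ∫⁻ t, ‖A (x, t)‖ₑ ^ 2 := fun A => by
    have := ((Lp.stronglyMeasurable A).measurable.enorm.pow_const 2).lintegral_prod_right'
      (ν := (volume : Measure ℝ))
    exact this
  set D : ℕ → ℝ → ENNReal := fun n x =>
    (∫⁻ t, ‖(F - Fn n) (x, t)‖ₑ ^ 2) + ∫⁻ t, ‖(Gn n - G) (x, t)‖ₑ ^ 2 with hD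
  have hDint : ∀ n, ∫⁻ x, D n x = ‖F - Fn n‖ₑ ^ 2 + ‖Gn n - G‖ₑ ^ 2 := fun n => by
    rw [enorm_sq_L2_prod, enorm_sq_L2_prod, lintegral_add_left (hmeas _)]
  have hlim : Filter.Tendsto (fun n => ∫⁻ x, D n x) Filter.atTop (nhds 0) := by
    have a1 : Filter.Tendsto (fun n => ‖F - Fn n‖ₑ ^ 2) Filter.atTop (nhds 0) := by
      have := ((continuous_enorm.tendsto _).comp (hF.const_sub F))
      simpa using ENNReal.Tendsto.pow (n := 2) this
    have a2 : Filter.Tendsto (fun n => ‖Gn n - G‖ₑ ^ 2) Filter.atTop (nhds 0) := by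
      have := ((continuous_enorm.tendsto _).comp (hG.sub_const G))
      simpa using ENNReal.Tendsto.pow (n := 2) this
    simpa [hDint] using a1.add a2
  have hI : ∫⁻ x, (⨅ n, D n x) = 0 := by
    apply le_antisymm _ (zero_le)
    exact ge_of_tendsto' hlim fun n => lintegral_mono fun x => iInf_le _ n
  have hI0 : ∀ᵐ x, (⨅ n, D n x) = 0 := by
    have hm : Measurable fun x => ⨅ n, D n x :=
      Measurable.iInf fun n => (hmeas _).add (hmeas _)
    simpa [Filter.EventuallyEq] using (lintegral_eq_zero_iff hm).1 hI
  filter_upwards [hI0, memLp_slices F, memLp_slices G, ae_all_iff.2 h,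
    ae_all_iff.2 fun n => coeFn_sub_slices F (Fn n),
    ae_all_iff.2 fun n => coeFn_sub_slices (Gn n) G] with x hx hFx hGx hn hsF hsG
  refine ⟨hFx.toLp, hFx.coeFn_toLp, ?_⟩
  suffices hsuff : (𝓕 hFx.toLp : L2 ℝ) = hGx.toLp by
    rw [hsuff]; exact hGx.coeFn_toLp
  have bound : ∀ n, ‖(𝓕 hFx.toLp : L2 ℝ) - hGx.toLp‖ₑ ^ 2 ≤ 4 * D n x := by
    intro n
    obtain ⟨f, hf, hg⟩ := hn n
    have e1 : ∫⁻ t, ‖(F - Fn n) (x, t)‖ₑ ^ 2 = ‖hFx.toLp - f‖ₑ ^ 2 := by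
      rw [enorm_sq_L2]
      apply lintegral_congr_ae
      filter_upwards [Lp.coeFn_sub hFx.toLp f, hFx.coeFn_toLp, hf, hsF n] with t b1 b2 b3 b4
      rw [b1, b4, Pi.sub_apply, b2, b3]
    have e2 : ∫⁻ t, ‖(Gn n - G) (x, t)‖ₑ ^ 2 = ‖(𝓕 f : L2 ℝ) - hGx.toLp‖ₑ ^ 2 := by
      rw [enorm_sq_L2]
      apply lintegral_congr_ae
      filter_upwards [Lp.coeFn_sub (𝓕 f : L2 ℝ) hGx.toLp, hGx.coeFn_toLp, hg, hsG n]
        with t b1 b2 b3 b4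
      rw [b1, b4, Pi.sub_apply, b2, b3]
    have e3 : ‖(𝓕 hFx.toLp : L2 ℝ) - 𝓕 f‖ₑ = ‖hFx.toLp - f‖ₑ := by
      have : (𝓕 (hFx.toLp - f) : L2 ℝ) = 𝓕 hFx.toLp - 𝓕 f :=
        (Lp.fourierTransformₗᵢ ℝ ℂ).map_sub _ f
      rw [← this, ← ofReal_norm, ← ofReal_norm, Lp.norm_fourier_eq]
    have tri : ‖(𝓕 hFx.toLp : L2 ℝ) - hGx.toLp‖ₑ ≤
        ‖hFx.toLp - f‖ₑ + ‖(𝓕 f : L2 ℝ) - hGx.toLp‖ₑ := by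
      rw [← e3, ← sub_add_sub_cancel _ (𝓕 f : L2 ℝ) _]
      exact enorm_add_le _ _
    simp only [hD]
    rw [e1, e2]
    generalize ‖hFx.toLp - f‖ₑ = a at *
    generalize ‖(𝓕 f : L2 ℝ) - hGx.toLp‖ₑ = b at *
    calc _ ≤ (a + b) ^ 2 := by gcongr
      _ ≤ (2 * max a b) ^ 2 := by
        gcongr
        rw [two_mul]
        gcongr
        exacts [le_max_left _ _, le_max_right _ _]
      _ = 4 * (max a b) ^ 2 := by rw [mul_pow]; norm_num
      _ ≤ _ := by
        gcongr
        rcases max_choice a b with h | h <;> rw [h]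
        exacts [le_self_add, le_add_self]
  have hz : ‖(𝓕 hFx.toLp : L2 ℝ) - hGx.toLp‖ₑ ^ 2 ≤ 4 * ⨅ n, D n x := by
    rw [ENNReal.mul_iInf_of_ne (by norm_num) (by norm_num)]
    exact le_iInf bound
  rw [hx, mul_zero, nonpos_iff_eq_zero, pow_eq_zero_iff (by norm_num), enorm_eq_zero,
    sub_eq_zero] at hz
  exact hz

/-- Every `F ∈ L²(ℝ × ℝ)` has a Fourier transform in the second variable. -/
theorem exists_isPartialFourier (F : L2 (ℝ × ℝ)) : ∃ G, IsPartialFourier F G := by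
  have hd := Lp.dense_hasCompactSupport_contDiff (E := ℝ × ℝ) (F := ℂ) (μ := volume) (p := 2)
    (by norm_num)
  obtain ⟨Fn, hFn, hlim⟩ := mem_closure_iff_seq_limit.1 (hd F)
  have hex : ∀ n, ∃ G, IsPartialFourier (Fn n) G := fun n => by
    obtain ⟨g, h1, h2, h3⟩ := hFn n
    exact exists_isPartialFourier_of_continuous _ g h1 h2 h3.continuous
  choose Gn hGn using hex
  have hC : CauchySeq Gn := by
    have hc := hlim.cauchySeq
    rw [Metric.cauchySeq_iff] at hc ⊢
    intro ε hε
    obtain ⟨N, hN⟩ := hc ε hε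
    refine ⟨N, fun m hm n hn => ?_⟩
    rw [dist_eq_norm, ((hGn m).sub (hGn n)).norm_eq, ← dist_eq_norm]
    exact hN m hm n hn
  obtain ⟨G, hG⟩ := cauchySeq_tendsto_of_complete hC
  exact ⟨G, IsPartialFourier.of_tendsto hGn hlim hG⟩

/-! ### Hilbert-Schmidt operators and operator Paley-Wiener spaces -/

/-- The rotation `(t, ν) ↦ (ν, -t)` into the Euclidean plane preserves Lebesgue measure. -/
theorem measurePreserving_rotation :
    MeasurePreserving (fun z : ℝ × ℝ => WithLp.toLp 2 (z.2, -z.1)) volume volume := by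
  have h1 : MeasurePreserving (Prod.swap : ℝ × ℝ → ℝ × ℝ) volume volume :=
    Measure.measurePreserving_swap
  have h2 : MeasurePreserving (Prod.map id Neg.neg : ℝ × ℝ → ℝ × ℝ) volume volume :=
    (MeasurePreserving.id (volume : Measure ℝ)).prod
      (Measure.measurePreserving_neg (volume : Measure ℝ))
  exact (WithLp.volume_preserving_toLp ℝ ℝ).comp (h2.comp h1)

/-- The symplectic Fourier transform on `L²(ℝ²)`,
`(𝓕ₛ F)(t, ν) = ∫∫ F(x, ξ) e^{-2πi(νx - ξt)} dx dξ` (in the `L²` sense), that is,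
`(𝓕ₛ F)(t, ν) = (𝓕 F)(ν, -t)` with `𝓕` the `L²` Fourier transform of the Euclidean plane. -/
def symplecticFourier (F : L2 (ℝ × ℝ)) : L2 (ℝ × ℝ) :=
  Lp.compMeasurePreserving (fun z : ℝ × ℝ => WithLp.toLp 2 (z.2, -z.1)) measurePreserving_rotation
    (𝓕 (Lp.compMeasurePreserving WithLp.ofLp (WithLp.volume_preserving_ofLp ℝ ℝ) F) :
      L2 (WithLp 2 (ℝ × ℝ)))

/-- `H` is the integral operator on `L²(ℝ)` with kernel `κ`: `H f (x) = ∫ κ(x, t) f(t) dt`. -/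
def IsKernel (H : L2 ℝ →L[ℂ] L2 ℝ) (κ : L2 (ℝ × ℝ)) : Prop :=
  ∀ f : L2 ℝ, H f =ᵐ[volume] fun x => ∫ t, κ (x, t) * f t

/-- Hilbert-Schmidt operators on `L²(ℝ)`: the bounded linear operators which are integral
operators with a kernel in `L²(ℝ²)`. -/
structure HilbertSchmidt where
  /-- the bounded operator -/
  op : L2 ℝ →L[ℂ] L2 ℝ
  exists_kernel : ∃ κ : L2 (ℝ × ℝ), IsKernel op κ

namespace HilbertSchmidt

/-- The kernel `κ_H ∈ L²(ℝ²)` of `H` (it is unique). -/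
def kernel (H : HilbertSchmidt) : L2 (ℝ × ℝ) := H.exists_kernel.choose

theorem isKernel_kernel (H : HilbertSchmidt) : IsKernel H.op H.kernel := H.exists_kernel.choose_spec

/-- The Hilbert-Schmidt norm `‖H‖_HS = ‖κ_H‖_{L²}`. -/
def hsNorm (H : HilbertSchmidt) : ℝ := ‖H.kernel‖

/-- The time-varying impulse response `h_H(t, x) = κ_H(x, x - t)`, with the variables in the
order `(x, t)`. -/
def impulseResponse (H : HilbertSchmidt) : L2 (ℝ × ℝ) :=
  Lp.compMeasurePreserving (fun z : ℝ × ℝ => (z.1, z.1 - z.2)) measurePreserving_shear H.kernel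

/-- The Kohn-Nirenberg symbol `σ_H(x, ξ) = ∫ κ_H(x, x - t) e^{-2πitξ} dt`. -/
def symbol (H : HilbertSchmidt) : L2 (ℝ × ℝ) :=
  (exists_isPartialFourier H.impulseResponse).choose

theorem isPartialFourier_symbol (H : HilbertSchmidt) :
    IsPartialFourier H.impulseResponse H.symbol :=
  (exists_isPartialFourier H.impulseResponse).choose_spec

/-- The spreading function `η_H(t, ν)`: the symplectic Fourier transform of the Kohn-Nirenberg
symbol of `H`. -/
def spreading (H : HilbertSchmidt) : L2 (ℝ × ℝ) := symplecticFourier H.symbol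

end HilbertSchmidt

/-- The operator Paley-Wiener space of the closed set `S`: the Hilbert-Schmidt operators `H` with
`supp 𝓕ₛ σ_H ⊆ S`. For a class in `L²` and a closed `S` this says that `𝓕ₛ σ_H` vanishes almost
everywhere off `S`. -/
def OPW (S : Set (ℝ × ℝ)) : Set HilbertSchmidt :=
  {H | ∀ᵐ z : ℝ × ℝ, z ∉ S → symplecticFourier H.symbol z = 0}

/-! ### Action of an operator on tempered distributions -/

/-- The characters of `ℝ` have temperate growth, so that they multiply tempered distributions. -/
theorem hasTemperateGrowth_character (ν : ℝ) :
    Function.HasTemperateGrowth (fun x : ℝ => (Real.fourierChar (ν * x) : ℂ)) := by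
  set c : ℂ := 2 * Real.pi * ν * Complex.I with hc
  have e : (fun x : ℝ => (Real.fourierChar (ν * x) : ℂ)) =
      fun x : ℝ => Complex.exp (c * Complex.ofRealCLM x) := by
    ext x
    rw [Real.fourierChar_apply, hc, Complex.ofRealCLM_apply]
    congr 1
    push_cast
    ring
  have hd : ∀ n : ℕ, iteratedDeriv n (fun x : ℝ => Complex.exp (c * Complex.ofRealCLM x)) =
      fun x : ℝ => c ^ n * Complex.exp (c * Complex.ofRealCLM x) := by
    intro n
    induction n with
    | zero => simp
    | succ n ih =>
      rw [iteratedDeriv_succ, ih]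
      ext x
      have h1 : HasDerivAt (fun x : ℝ => c * Complex.ofRealCLM x) c x := by
        simpa using (Complex.ofRealCLM.hasDerivAt (x := x)).const_mul c
      rw [(h1.cexp.const_mul (c ^ n)).deriv]
      ring
  refine ⟨by rw [e]; fun_prop, fun n => ⟨0, ‖c ^ n‖, fun x => ?_⟩⟩
  rw [norm_iteratedFDeriv_eq_norm_iteratedDeriv, e, hd]
  have hx : ‖Complex.exp (c * Complex.ofRealCLM x)‖ = 1 := by
    rw [← congrFun e x]
    exact Circle.norm_coe _
  simp only [norm_mul, hx]
  simp

/-- Translation `T_t f (x) = f (x - t)` of tempered distributions, `(T_t f)(g) = f(g(· + t))`. -/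
def translation (t : ℝ) : 𝓢'(ℝ, ℂ) →L[ℂ] 𝓢'(ℝ, ℂ) :=
  PointwiseConvergenceCLM.precomp _ (SchwartzMap.compSubConstCLM ℂ (-t))

/-- Modulation `M_ν f (x) = e^{2πiνx} f (x)` of tempered distributions. -/
def modulation (ν : ℝ) : 𝓢'(ℝ, ℂ) →L[ℂ] 𝓢'(ℝ, ℂ) :=
  TemperedDistribution.smulLeftCLM ℂ (fun x : ℝ => (Real.fourierChar (ν * x) : ℂ))

/-- `u = H f` for a tempered distribution `f` and `u ∈ L²(ℝ)`: the weak identity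
`⟨H f, g⟩ = ∫∫ η_H(t, ν) ⟨M_ν T_t f, g⟩ dt dν` for all Schwartz functions `g`, where the integral
converges absolutely. The brackets are the bilinear pairings of distributions with functions.
There is at most one such `u`. -/
def IsImage (H : HilbertSchmidt) (f : 𝓢'(ℝ, ℂ)) (u : L2 ℝ) : Prop :=
  ∀ g : 𝓢(ℝ, ℂ),
    Integrable (fun z : ℝ × ℝ => H.spreading z * modulation z.2 (translation z.1 f) g) ∧
    ∫ x, u x * g x = ∫ z : ℝ × ℝ, H.spreading z * modulation z.2 (translation z.1 f) g

/-- The terms `δ_{nN + α}`, `n ∈ ℤ`, of a delta train, as tempered distributions. -/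
def deltaTerm (N : ℕ) (α : ℝ) (n : ℤ) : 𝓢'(ℝ, ℂ) :=
  TemperedDistribution.delta ((n : ℝ) * N + α)

/-- The delta train `∑_{n ∈ ℤ} δ_{nN + α}`, a convergent series of tempered distributions if
`N ≠ 0`. -/
def deltaTrain (N : ℕ) (α : ℝ) : 𝓢'(ℝ, ℂ) := ∑' n : ℤ, deltaTerm N α n

end

end OperatorSampling

open OperatorSampling

namespace OperatorSampling

/-! Let `F` be the spreading function of `H`, supported in `[0,N) × (-M/2, M/2]` up to a null set.
Every `x` is uniquely `nN + a + t` with `t ∈ [0,N)`, so a single delta of the train at `nN + a`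
contributes at `x`, and the response there is `∫ F(t,ν) e^{2πiνx} dν` (`trainResponse`, justified
weakly in `integral_trainResponse_mul`). Its energy is the integral over `t` of the energy of the
samples of the inverse Fourier transform of the slice `F(t,·)` at the points `nN + a + t`.

The claim thus becomes a sampling theorem for each slice, with constants independent of `t`
(`exists_sampling_bounds`). The spectrum has length `M`, and the points `nN + α_j + t` have density
`M`. By Parseval, the samples for one `j` carry the energy of the `1/N`-periodization of the slice
times a character. This periodization folds `MN` pieces of length `1/N` onto each other. For all `j`
together, the folding acts at each point, up to unimodular factors, as the Vandermonde matrix with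
nodes `e^{2πiα_j/N}`. The nodes are distinct because the `α_j` are distinct in `[0,N)`, so the
matrix is invertible and bounded above and below (`exists_vandermonde_bounds`). Integration over `t`
gives the bounds in terms of `‖F‖²`, and `‖F‖ = ‖H‖_HS` by Plancherel. -/

theorem norm_character (x : ℝ) : ‖(𝐞 x : ℂ)‖ = 1 := Circle.norm_coe _

theorem enorm_character (x : ℝ) : ‖(𝐞 x : ℂ)‖ₑ = 1 := by
  rw [← ofReal_norm, norm_character, ENNReal.ofReal_one]

/-! ### Delta trains as tempered distributions -/

/-- A Peetre-type inequality: it trades decay at the shifted lattice point for decay in `n`, at a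
polynomial cost in the shift. It uses `N ≥ 1`. -/
theorem one_add_abs_le_of_lattice {N : ℕ} (hN : 0 < N) (n : ℤ) (s : ℝ) :
    1 + |(n : ℝ)| ≤ (1 + |(n : ℝ) * N + s|) * (1 + |s|) := by
  have h1 : (1 : ℝ) ≤ N := by exact_mod_cast hN
  have h2 : |(n : ℝ)| ≤ |(n : ℝ) * N| := by
    rw [abs_mul, Nat.abs_cast]
    exact le_mul_of_one_le_right (abs_nonneg _) h1
  have h3 : |(n : ℝ) * N| ≤ |(n : ℝ) * N + s| + |s| := by
    simpa using abs_sub ((n : ℝ) * N + s) s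
  nlinarith [mul_nonneg (abs_nonneg ((n : ℝ) * N + s)) (abs_nonneg s)]

theorem summable_inv_one_add_abs_sq : Summable fun n : ℤ => ((1 + |(n : ℝ)|) ^ 2)⁻¹ := by
  have h := Real.summable_one_div_int_pow (p := 2) |>.2 (by norm_num)
  refine Summable.of_norm_bounded_eventually h ?_
  filter_upwards [(Set.finite_singleton (0 : ℤ)).compl_mem_cofinite] with n hn
  have hn' : (n : ℝ) ≠ 0 := by exact_mod_cast hn
  rw [norm_inv, norm_pow, Real.norm_of_nonneg (by positivity : (0 : ℝ) ≤ 1 + |(n : ℝ)|), one_div,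
    ← sq_abs (n : ℝ)]
  have : 0 < |(n : ℝ)| := abs_pos.2 hn'
  gcongr
  linarith

/-- A Schwartz seminorm controlling `(1 + |x|)² |g x|`. -/
noncomputable def decaySeminorm : Seminorm ℂ 𝓢(ℝ, ℂ) :=
  (Finset.Iic ((2, 0) : ℕ × ℕ)).sup (schwartzSeminormFamily ℂ ℝ ℂ)

/-- The explicit dependence on `s` matters: for `s` in a bounded set one summable majorant serves
all shifts, which later allows the exchange of sum and integral. -/
theorem norm_lattice_le {N : ℕ} (hN : 0 < N) (g : 𝓢(ℝ, ℂ)) (n : ℤ) (s : ℝ) :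
    ‖g ((n : ℝ) * N + s)‖ ≤
      4 * decaySeminorm g * (1 + |s|) ^ 2 * ((1 + |(n : ℝ)|) ^ 2)⁻¹ := by
  have h := SchwartzMap.one_add_le_sup_seminorm_apply (𝕜 := ℂ) (m := (2, 0)) (k := 2) (n := 0)
    le_rfl le_rfl g ((n : ℝ) * N + s)
  rw [norm_iteratedFDeriv_zero, Real.norm_eq_abs] at h
  have h' : (1 + |(n : ℝ) * N + s|) ^ 2 * ‖g ((n : ℝ) * N + s)‖ ≤ 4 * decaySeminorm g := by
    refine h.trans (le_of_eq ?_)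
    norm_num [decaySeminorm]
    rfl
  have h2 := one_add_abs_le_of_lattice hN n s
  rw [← div_eq_mul_inv, le_div_iff₀ (by positivity)]
  calc ‖g ((n : ℝ) * N + s)‖ * (1 + |(n : ℝ)|) ^ 2
      ≤ ‖g ((n : ℝ) * N + s)‖ * ((1 + |(n : ℝ) * N + s|) * (1 + |s|)) ^ 2 := by gcongr
    _ = ((1 + |(n : ℝ) * N + s|) ^ 2 * ‖g ((n : ℝ) * N + s)‖) * (1 + |s|) ^ 2 := by ring
    _ ≤ _ := by gcongr

theorem summable_lattice {N : ℕ} (hN : 0 < N) (g : 𝓢(ℝ, ℂ)) (s : ℝ) :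
    Summable fun n : ℤ => g ((n : ℝ) * N + s) :=
  Summable.of_norm_bounded (summable_inv_one_add_abs_sq.mul_left _)
    fun n => norm_lattice_le hN g n s

/-- The limit is the functional `g ↦ ∑ g(nN + s)`, continuous because a Schwartz seminorm bounds it.
Convergence of distributions is pointwise, so it reduces to `summable_lattice`. -/
theorem summable_deltaTerm {N : ℕ} (hN : 0 < N) (s : ℝ) : Summable (deltaTerm N s) := by
  let T : 𝓢(ℝ, ℂ) →L[ℂ] ℂ := SchwartzMap.mkCLMtoNormedSpace
    (fun g => ∑' n : ℤ, g ((n : ℝ) * N + s))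
    (fun f g => (summable_lattice hN f s).tsum_add (summable_lattice hN g s))
    (fun a f => by simp [tsum_mul_left])
    ⟨Finset.Iic (2, 0), ∑' n : ℤ, 4 * (1 + |s|) ^ 2 * ((1 + |(n : ℝ)|) ^ 2)⁻¹,
      tsum_nonneg fun n => by positivity, fun g => by
        have hs := summable_inv_one_add_abs_sq.mul_left (4 * (1 + |s|) ^ 2)
        rw [mul_comm, ← tsum_mul_left]
        refine tsum_of_norm_bounded (hs.mul_left _).hasSum fun n =>
          (norm_lattice_le hN g n s).trans (le_of_eq ?_)
        change _ = decaySeminorm g * _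
        ring⟩
  refine ⟨ContinuousLinearMap.toPointwiseConvergenceCLM _ _ _ _ T, ?_⟩
  rw [HasSum, PointwiseConvergenceCLM.tendsto_iff_forall_tendsto]
  intro g
  have h := (summable_lattice hN g s).hasSum
  rw [HasSum] at h
  convert! h using 2 with A
  induction A using Finset.induction_on with
  | empty => simp
  | insert a A ha ih =>
    rw [Finset.sum_insert ha, Finset.sum_insert ha, add_apply, ih]
    rfl

theorem deltaTrain_apply {N : ℕ} (hN : 0 < N) (s : ℝ) (g : 𝓢(ℝ, ℂ)) :
    deltaTrain N s g = ∑' n : ℤ, g ((n : ℝ) * N + s) := by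
  have h := (summable_deltaTerm hN s).hasSum
  rw [HasSum, PointwiseConvergenceCLM.tendsto_iff_forall_tendsto] at h
  refine ((summable_lattice hN g s).hasSum.unique ?_).symm
  rw [HasSum]
  convert! h g using 2 with A
  induction A using Finset.induction_on with
  | empty => simp
  | insert a A ha ih =>
    rw [Finset.sum_insert ha, Finset.sum_insert ha, add_apply, ih]
    rfl

theorem modulation_translation_deltaTrain {N : ℕ} (hN : 0 < N) (s t ν : ℝ) (g : 𝓢(ℝ, ℂ)) :
    modulation ν (translation t (deltaTrain N s)) g =
      ∑' n : ℤ, (𝐞 (ν * ((n : ℝ) * N + (s + t))) : ℂ) * g ((n : ℝ) * N + (s + t)) := by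
  have : modulation ν (translation t (deltaTrain N s)) g = deltaTrain N s
      (SchwartzMap.compSubConstCLM ℂ (-t) (SchwartzMap.smulLeftCLM ℂ
        (fun x : ℝ => (Real.fourierChar (ν * x) : ℂ)) g)) := rfl
  rw [this, deltaTrain_apply hN]
  refine tsum_congr fun n => ?_
  rw [SchwartzMap.compSubConstCLM_apply,
    SchwartzMap.smulLeftCLM_apply_apply (hasTemperateGrowth_character ν), smul_eq_mul,
    sub_neg_eq_add, add_assoc]

/-! ### The Hilbert-Schmidt norm and the spreading function -/

theorem norm_symplecticFourier (F : L2 (ℝ × ℝ)) : ‖symplecticFourier F‖ = ‖F‖ := by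
  rw [symplecticFourier, Lp.norm_compMeasurePreserving, Lp.norm_fourier_eq,
    Lp.norm_compMeasurePreserving]

/-- Each passage from kernel to spreading function is isometric: a measure-preserving shear, a
partial Fourier transform, and the symplectic Fourier transform. -/
theorem HilbertSchmidt.norm_spreading (H : HilbertSchmidt) : ‖H.spreading‖ = H.hsNorm := by
  rw [spreading, norm_symplecticFourier, H.isPartialFourier_symbol.norm_eq, impulseResponse,
    Lp.norm_compMeasurePreserving, hsNorm]

/-! ### Frame bounds of Vandermonde matrices -/

/-- An injective linear map in finite dimension is bounded below. The bounds are in `ℝ≥0∞` so that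
they can be integrated without integrability conditions. -/
theorem exists_vandermonde_bounds {K : ℕ} {z : Fin K → ℂ} (hz : Function.Injective z) :
    ∃ c C : NNReal, 0 < c ∧ 0 < C ∧ ∀ v : Fin K → ℂ,
      c * ∑ k, ‖v k‖ₑ ^ 2 ≤ ∑ j, ‖∑ k, v k * z j ^ (k : ℕ)‖ₑ ^ 2 ∧
      ∑ j, ‖∑ k, v k * z j ^ (k : ℕ)‖ₑ ^ 2 ≤ C * ∑ k, ‖v k‖ₑ ^ 2 := by
  set A : EuclideanSpace ℂ (Fin K) →ₗ[ℂ] EuclideanSpace ℂ (Fin K) :=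
    Matrix.toEuclideanLin (Matrix.vandermonde z) with hA
  have hAapp : ∀ v j, A (WithLp.toLp 2 v) j = ∑ k, v k * z j ^ (k : ℕ) := fun v j => by
    simp [hA, Matrix.toLpLin_apply, Matrix.mulVec, dotProduct, Matrix.vandermonde_apply, mul_comm]
  have hker : A.ker = ⊥ := by
    rw [LinearMap.ker_eq_bot']
    intro v hv
    have hdet := Matrix.det_vandermonde_ne_zero_iff.2 hz
    have h0 : (Matrix.vandermonde z).mulVec v.ofLp = 0 := by
      have := congrArg WithLp.ofLp hv
      simpa [hA, Matrix.toLpLin_apply] using this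
    ext k
    simpa using congrFun (Matrix.eq_zero_of_mulVec_eq_zero hdet h0) k
  have hnorm : ∀ w : EuclideanSpace ℂ (Fin K), ‖w‖ₑ ^ 2 = ∑ k, ‖w k‖ₑ ^ 2 := fun w => by
    simp only [← ofReal_norm, ← ENNReal.ofReal_pow (norm_nonneg _)]
    rw [EuclideanSpace.norm_sq_eq, ENNReal.ofReal_sum_of_nonneg fun _ _ => by positivity]
  obtain ⟨L, hL, hanti⟩ := A.exists_antilipschitzWith hker
  set B := LinearMap.toContinuousLinearMap A
  -- The `+ 1` keeps the upper constant positive when `B = 0`, as for `K = 0`.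
  refine ⟨(L ^ 2)⁻¹, (‖B‖₊ + 1) ^ 2, by positivity, by positivity, fun v => ⟨?_, ?_⟩⟩
  · have h1 : ‖WithLp.toLp 2 v‖ₑ ≤ L * ‖A (WithLp.toLp 2 v)‖ₑ := by
      simpa [edist_eq_enorm_sub] using hanti (WithLp.toLp 2 v) 0
    have h2 : ‖WithLp.toLp 2 v‖ₑ ^ 2 ≤ (L * ‖A (WithLp.toLp 2 v)‖ₑ) ^ 2 := by gcongr
    rw [mul_pow, hnorm, hnorm] at h2
    simp only [hAapp] at h2
    rw [ENNReal.coe_inv (by positivity), ENNReal.inv_mul_le_iff (by positivity) (by simp)]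
    simpa using h2
  · have h1 : ‖A (WithLp.toLp 2 v)‖ₑ ≤ (‖B‖₊ + 1 : NNReal) * ‖WithLp.toLp 2 v‖ₑ := by
      have h : ‖A (WithLp.toLp 2 v)‖₊ ≤ ‖B‖₊ * ‖WithLp.toLp 2 v‖₊ := B.le_opNNNorm _
      rw [enorm_eq_nnnorm, enorm_eq_nnnorm, ← ENNReal.coe_mul, ENNReal.coe_le_coe]
      exact h.trans (by gcongr; simp)
    have h2 : ‖A (WithLp.toLp 2 v)‖ₑ ^ 2 ≤
      ((‖B‖₊ + 1 : NNReal) * ‖WithLp.toLp 2 v‖ₑ) ^ 2 := by gcongr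
    rw [mul_pow, hnorm, hnorm] at h2
    simp only [hAapp] at h2
    simpa using h2

/-! ### Periodization and Parseval's identity -/

theorem setLIntegral_Ioc_nsmul (f : ℝ → ENNReal) (b : ℝ) {T : ℝ} (hT : 0 ≤ T) (K : ℕ) :
    ∫⁻ x in Set.Ioc b (b + K * T), f x =
      ∑ k ∈ Finset.range K, ∫⁻ x in Set.Ioc 0 T, f (b + k * T + x) := by
  induction K with
  | zero => simp
  | succ K ih =>
    have e : Set.Ioc b (b + (K + 1 : ℕ) * T) =
        Set.Ioc b (b + K * T) ∪ Set.Ioc (b + K * T) (b + K * T + T) := by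
      rw [Set.Ioc_union_Ioc_eq_Ioc (by nlinarith [mul_nonneg K.cast_nonneg hT]) (by linarith)]
      push_cast; ring_nf
    rw [Finset.sum_range_succ, ← ih, e, lintegral_union measurableSet_Ioc
      (Set.Ioc_disjoint_Ioc_of_le le_rfl)]
    congr 1
    rw [← (measurePreserving_add_left volume (b + K * T)).setLIntegral_comp_preimage_emb
      (measurableEmbedding_addLeft _) f]
    congr 2
    simp

theorem setIntegral_Ioc_nsmul {f : ℝ → ℂ} (hf : Integrable f) (b : ℝ) {T : ℝ} (hT : 0 ≤ T)
    (K : ℕ) : ∫ x in Set.Ioc b (b + K * T), f x =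
      ∫ x in Set.Ioc 0 T, ∑ k ∈ Finset.range K, f (b + k * T + x) := by
  rw [integral_finsetSum _ fun k _ => (hf.comp_add_left _).integrableOn]
  induction K with
  | zero => simp
  | succ K ih =>
    have e : Set.Ioc b (b + (K + 1 : ℕ) * T) =
        Set.Ioc b (b + K * T) ∪ Set.Ioc (b + K * T) (b + K * T + T) := by
      rw [Set.Ioc_union_Ioc_eq_Ioc (by nlinarith [mul_nonneg K.cast_nonneg hT]) (by linarith)]
      push_cast; ring_nf
    rw [Finset.sum_range_succ, ← ih, e, setIntegral_union
      (Set.Ioc_disjoint_Ioc_of_le le_rfl) measurableSet_Ioc hf.integrableOn hf.integrableOn]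
    congr 1
    rw [← (measurePreserving_add_left volume (b + K * T)).setIntegral_preimage_emb
      (measurableEmbedding_addLeft _) f]
    congr 2
    simp

/-- Parseval's identity on an interval, for the exponentials `e^{2πinx/T}`. -/
theorem tsum_enorm_sq_integral_character {T : ℝ} (hT : 0 < T) {P : ℝ → ℂ}
    (hP : MemLp P 2 (volume.restrict (Set.Ioc 0 T))) :
    ∑' n : ℤ, ‖∫ x in Set.Ioc 0 T, P x * (𝐞 (x * (n * T⁻¹)) : ℂ)‖ₑ ^ 2 =
      ENNReal.ofReal T * ∫⁻ x in Set.Ioc 0 T, ‖P x‖ₑ ^ 2 := by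
  have h := hasSum_sq_fourierCoeffOn hT hP
  -- Fourier coefficients are taken against `e^{-2πinx/T}` and normalized by `1/T`; hence the index
  -- `-n` and the factor `T`.
  have e : ∀ n : ℤ, ∫ x in Set.Ioc 0 T, P x * (𝐞 (x * (n * T⁻¹)) : ℂ) =
      (T : ℂ) * fourierCoeffOn hT P (-n) := by
    intro n
    rw [fourierCoeffOn_eq_integral, intervalIntegral.integral_of_le hT.le, Complex.real_smul,
      ← mul_assoc]
    have hT' : (T : ℂ) ≠ 0 := by exact_mod_cast hT.ne'
    simp only [sub_zero, one_div, Complex.ofReal_inv]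
    rw [mul_inv_cancel₀ hT', one_mul]
    refine integral_congr_ae (Filter.Eventually.of_forall fun x => ?_)
    simp only [neg_neg, smul_eq_mul, fourier_coe_apply, Real.fourierChar_apply]
    rw [mul_comm]
    congr 2
    push_cast
    field_simp
    rw [sub_zero]
  have h2 : HasSum (fun n : ℤ => T ^ 2 * ‖fourierCoeffOn hT P (-n)‖ ^ 2) _ :=
    ((Equiv.neg ℤ).hasSum_iff.2 h).mul_left (T ^ 2)
  have h3 := h2.tsum_eq
  have e2 : ∀ n : ℤ, ‖∫ x in Set.Ioc 0 T, P x * (𝐞 (x * (n * T⁻¹)) : ℂ)‖ₑ ^ 2 =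
      ENNReal.ofReal (T ^ 2 * ‖fourierCoeffOn hT P (-n)‖ ^ 2) := fun n => by
    rw [e, ← ofReal_norm, ← ENNReal.ofReal_pow (norm_nonneg _), norm_mul, mul_pow,
      Complex.norm_real, Real.norm_of_nonneg hT.le]
  have hint := (memLp_two_iff_integrable_sq_norm hP.1).1 hP
  simp_rw [e2]
  have e3 : ∫⁻ x in Set.Ioc 0 T, ‖P x‖ₑ ^ 2 = ENNReal.ofReal (∫ x in Set.Ioc 0 T, ‖P x‖ ^ 2) := by
    rw [ofReal_integral_eq_lintegral_ofReal hint
      (Filter.Eventually.of_forall fun x => by positivity)]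
    simp [← ofReal_norm, ENNReal.ofReal_pow]
  rw [← ENNReal.ofReal_tsum_of_nonneg (fun n => by positivity) h2.summable, e3,
    ← ENNReal.ofReal_mul hT.le]
  congr 1
  refine h3.trans ?_
  rw [intervalIntegral.integral_of_le hT.le, smul_eq_mul, sub_zero]
  field_simp

/-- Parseval's identity for the `K`-fold periodization of a function of compact support. -/
theorem tsum_enorm_sq_integral_periodization {T : ℝ} (hT : 0 < T) {φ : ℝ → ℂ}
    (h1 : Integrable φ) (h2 : MemLp φ 2) (b : ℝ) (K : ℕ)
    (hφ : ∀ x, x ∉ Set.Ioc b (b + K * T) → φ x = 0) :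
    ∑' n : ℤ, ‖∫ x, φ x * (𝐞 (x * (n * T⁻¹)) : ℂ)‖ₑ ^ 2 =
      ENNReal.ofReal T * ∫⁻ x in Set.Ioc 0 T, ‖∑ k : Fin K, φ (b + k * T + x)‖ₑ ^ 2 := by
  have hP : MemLp (fun x => ∑ k : Fin K, φ (b + k * T + x)) 2 (volume.restrict (Set.Ioc 0 T)) :=
    memLp_finsetSum _ fun k _ =>
      (h2.comp_measurePreserving (measurePreserving_add_left volume (b + k * T))).restrict _
  rw [← tsum_enorm_sq_integral_character hT hP]
  refine tsum_congr fun n => ?_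
  have hint : Integrable fun x => φ x * (𝐞 (x * (n * T⁻¹)) : ℂ) := by
    refine h1.mul_bdd (c := 1) ?_ (Filter.Eventually.of_forall fun x => (norm_character _).le)
    exact Continuous.aestronglyMeasurable (by fun_prop)
  have e1 : ∫ x, φ x * (𝐞 (x * (n * T⁻¹)) : ℂ) =
      ∫ x in Set.Ioc b (b + K * T), φ x * (𝐞 (x * (n * T⁻¹)) : ℂ) :=
    (setIntegral_eq_integral_of_forall_compl_eq_zero fun x hx => by rw [hφ x hx, zero_mul]).symm
  rw [e1, setIntegral_Ioc_nsmul hint b hT.le]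
  -- A shift by `kT` changes the character by `e^{2πikn} = 1`, so all pieces fold under one
  -- character; only a unimodular factor from `b` remains.
  have e2 : ∀ x, ∑ k ∈ Finset.range K,
      φ (b + k * T + x) * (𝐞 ((b + k * T + x) * (n * T⁻¹)) : ℂ) =
      (𝐞 (b * (n * T⁻¹)) : ℂ) *
        ((∑ k : Fin K, φ (b + k * T + x)) * (𝐞 (x * (n * T⁻¹)) : ℂ)) := by
    intro x
    rw [Finset.sum_range, Finset.sum_mul, Finset.mul_sum]
    refine Finset.sum_congr rfl fun k _ => ?_
    have : (b + (k : ℕ) * T + x) * (n * T⁻¹) = b * (n * T⁻¹) + x * (n * T⁻¹) + (k * n : ℤ) := by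
      push_cast; field_simp; ring
    have hi : (𝐞 (((k : ℕ) * n : ℤ) : ℝ) : ℂ) = 1 := by
      rw [Real.fourierChar_apply, Complex.exp_eq_one_iff]
      exact ⟨(k : ℕ) * n, by push_cast; ring⟩
    rw [this, AddChar.map_add_eq_mul, AddChar.map_add_eq_mul]
    push_cast at hi ⊢
    rw [hi]
    ring
  simp_rw [e2]
  rw [integral_const_mul, enorm_mul, enorm_character, one_mul]

/-! ### Periodic nonuniform sampling of bandlimited functions -/

/-- Equal values force `x - y ∈ Nℤ`, and the half-open interval of length `N` leaves only `0`. This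
makes the Vandermonde nodes distinct. -/
theorem character_injOn {N : ℕ} (hN : 0 < N) {x y : ℝ} (hx : x ∈ Set.Ico (0 : ℝ) N)
    (hy : y ∈ Set.Ico (0 : ℝ) N) (h : (𝐞 ((N : ℝ)⁻¹ * x) : ℂ) = 𝐞 ((N : ℝ)⁻¹ * y)) : x = y := by
  have hN' : (0 : ℝ) < N := by exact_mod_cast hN
  rw [Real.fourierChar_apply, Real.fourierChar_apply, Complex.exp_eq_exp_iff_exists_int] at h
  obtain ⟨n, hn⟩ := h
  have h1 : ((2 * Real.pi * ((N : ℝ)⁻¹ * x) : ℝ) : ℂ) =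
      ((2 * Real.pi * ((N : ℝ)⁻¹ * y) + n * (2 * Real.pi) : ℝ) : ℂ) := by
    apply mul_right_cancel₀ Complex.I_ne_zero
    rw [hn]; push_cast; ring
  have h2 : x = y + n * N := by
    have := Complex.ofReal_injective h1
    field_simp at this
    nlinarith [Real.pi_pos]
  obtain ⟨hx0, hxN⟩ := hx
  obtain ⟨hy0, hyN⟩ := hy
  have h3 : (n : ℝ) < 1 := by
    by_contra hc; push Not at hc; nlinarith
  have h4 : (-1 : ℝ) < n := by
    by_contra hc; push Not at hc; nlinarith
  have h5 : n = 0 := by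
    have a1 : n < 1 := by exact_mod_cast h3
    have a2 : -1 < n := by exact_mod_cast h4
    omega
  simpa [h5] using h2

/-- The points `nN + α_j + t` form a set of sampling for functions with spectrum in an interval of
length `M`, with bounds independent of the shift `t`. -/
theorem exists_sampling_bounds {M N : ℕ} (hN : 0 < N) {α : Fin (M * N) → ℝ}
    (hα : Function.Injective α) (hαN : ∀ j, α j ∈ Set.Ico (0 : ℝ) N) :
    ∃ c C : NNReal, 0 < c ∧ 0 < C ∧ ∀ φ : ℝ → ℂ, Measurable φ → Integrable φ → MemLp φ 2 →
      (∀ x, x ∉ Set.Ioc (-(M : ℝ) / 2) (M / 2) → φ x = 0) → ∀ t : ℝ,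
      c * ∫⁻ x, ‖φ x‖ₑ ^ 2 ≤
        ∑ j, ∑' n : ℤ, ‖∫ x, φ x * (𝐞 (x * ((n : ℝ) * N + (α j + t))) : ℂ)‖ₑ ^ 2 ∧
      ∑ j, ∑' n : ℤ, ‖∫ x, φ x * (𝐞 (x * ((n : ℝ) * N + (α j + t))) : ℂ)‖ₑ ^ 2 ≤
        C * ∫⁻ x, ‖φ x‖ₑ ^ 2 := by
  have hN' : (0 : ℝ) < N := by exact_mod_cast hN
  have hNN : (0 : NNReal) < N := by exact_mod_cast hN
  obtain ⟨c, C, hc, hC, hcC⟩ := exists_vandermonde_bounds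
    (z := fun j => (𝐞 ((N : ℝ)⁻¹ * α j) : ℂ))
    fun i j h => hα (character_injOn hN (hαN i) (hαN j) h)
  refine ⟨(N : NNReal)⁻¹ * c, (N : NNReal)⁻¹ * C, by positivity, by positivity,
    fun φ hm h1 h2 hφ t => ?_⟩
  set T : ℝ := (N : ℝ)⁻¹ with hT
  have hTpos : 0 < T := by positivity
  have hTN : T⁻¹ = N := inv_inv _
  have hTe : ENNReal.ofReal T = ((N : NNReal)⁻¹ : NNReal) := by
    rw [← ENNReal.ofReal_coe_nnreal]; simp [hT]
  set b : ℝ := -(M : ℝ) / 2 with hb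
  -- Exactly `MN` intervals of length `T = 1/N` tile the spectral interval, so the matrix is square.
  have hend : b + (M * N : ℕ) * T = M / 2 := by
    rw [hb, hT]; push_cast; field_simp; ring
  -- The phase due to `t` goes into the vector, where it does not affect absolute values. The matrix
  -- then depends on `α` alone, and the bounds are uniform in `t`.
  set v : ℝ → Fin (M * N) → ℂ := fun x k => φ (b + k * T + x) * (𝐞 (k * T * t) : ℂ) with hv
  have hvn : ∀ x k, ‖v x k‖ₑ = ‖φ (b + k * T + x)‖ₑ := fun x k => by
    rw [hv, enorm_mul, enorm_character, mul_one]
  have hvm : ∀ k, Measurable fun x => v x k := fun k =>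
    (hm.comp (measurable_const_add _)).mul_const _
  have htotal : ∫⁻ x, ‖φ x‖ₑ ^ 2 = ∫⁻ x in Set.Ioc 0 T, ∑ k, ‖v x k‖ₑ ^ 2 := by
    have e1 : ∫⁻ x, ‖φ x‖ₑ ^ 2 = ∫⁻ x in Set.Ioc b (b + (M * N : ℕ) * T), ‖φ x‖ₑ ^ 2 := by
      rw [hend]
      refine (setLIntegral_eq_of_support_subset ?_).symm
      intro x hx
      by_contra hx'
      simp [hφ x hx'] at hx
    rw [e1, setLIntegral_Ioc_nsmul _ _ hTpos.le, Finset.sum_range,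
      lintegral_finsetSum _ fun k _ => ((hvm k).enorm.pow_const 2)]
    simp only [hvn]
  have hsamp : ∑ j, ∑' n : ℤ, ‖∫ x, φ x * (𝐞 (x * ((n : ℝ) * N + (α j + t))) : ℂ)‖ₑ ^ 2 =
      ENNReal.ofReal T * ∫⁻ x in Set.Ioc 0 T,
        ∑ j, ‖∑ k, v x k * (𝐞 (T * α j) : ℂ) ^ (k : ℕ)‖ₑ ^ 2 := by
    rw [lintegral_finsetSum _ fun j _ => (Finset.measurable_fun_sum _ fun k _ =>
      (hvm k).mul_const _).enorm.pow_const 2, Finset.mul_sum]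
    refine Finset.sum_congr rfl fun j _ => ?_
    have hcm : AEStronglyMeasurable (fun x : ℝ => (𝐞 (x * (α j + t)) : ℂ)) volume :=
      Continuous.aestronglyMeasurable (by fun_prop)
    have hψ1 : Integrable fun x => φ x * (𝐞 (x * (α j + t)) : ℂ) :=
      h1.mul_bdd (c := 1) hcm (Filter.Eventually.of_forall fun x => (norm_character _).le)
    have hψ2 : MemLp (fun x => φ x * (𝐞 (x * (α j + t)) : ℂ)) 2 :=
      h2.of_le (h1.1.mul hcm) (Filter.Eventually.of_forall fun x => by
        rw [norm_mul, norm_character, mul_one])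
    have := tsum_enorm_sq_integral_periodization hTpos hψ1 hψ2 b (M * N) fun x hx => by
      rw [hφ x (by rwa [hend] at hx), zero_mul]
    convert! this using 2
    · ext n
      congr 3
      ext x
      rw [hTN, mul_assoc, mul_add, AddChar.map_add_eq_mul]
      push_cast
      ring
    · refine lintegral_congr fun x => ?_
      -- The phase splits into a factor free of `k`, the phase of `v`, and the `k`-th power of the
      -- node.
      have e : ∑ k : Fin (M * N), φ (b + k * T + x) * (𝐞 ((b + k * T + x) * (α j + t)) : ℂ) =
          (𝐞 ((b + x) * (α j + t)) : ℂ) * ∑ k, v x k * (𝐞 (T * α j) : ℂ) ^ (k : ℕ) := by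
        rw [Finset.mul_sum]
        refine Finset.sum_congr rfl fun k _ => ?_
        have e1 : (b + (k : ℕ) * T + x) * (α j + t) =
            (b + x) * (α j + t) + ((k : ℕ) * T * t + (k : ℕ) • (T * α j)) := by
          rw [nsmul_eq_mul]; ring
        rw [e1, AddChar.map_add_eq_mul, AddChar.map_add_eq_mul, AddChar.map_nsmul_eq_pow, hv]
        push_cast
        ring
      rw [e, enorm_mul, enorm_character, one_mul]
  have hmt : Measurable fun x => ∑ k, ‖v x k‖ₑ ^ 2 :=
    Finset.measurable_fun_sum _ fun k _ => (hvm k).enorm.pow_const 2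
  rw [hsamp, htotal, hTe, ENNReal.coe_mul, ENNReal.coe_mul, mul_assoc, mul_assoc,
    ← lintegral_const_mul _ hmt, ← lintegral_const_mul _ hmt]
  constructor
  · gcongr with x
    exact (hcC (v x)).1
  · gcongr with x
    exact (hcC (v x)).2

/-! ### Decomposition of integrals over the line into periods -/

theorem lintegral_eq_tsum_period {N : ℕ} (hN : 0 < N) (a : ℝ) (f : ℝ → ENNReal) :
    ∫⁻ x, f x = ∑' n : ℤ, ∫⁻ t in Set.Ico (0 : ℝ) N, f ((n : ℝ) * N + (a + t)) := by
  have hN' : (0 : ℝ) < N := by exact_mod_cast hN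
  rw [← setLIntegral_univ, ← iUnion_Ico_add_zsmul hN' a,
    lintegral_iUnion (fun _ => measurableSet_Ico) (Set.pairwise_disjoint_Ico_add_zsmul _ _)]
  refine tsum_congr fun n => ?_
  rw [← (measurePreserving_add_left volume ((n : ℝ) * N + a)).setLIntegral_comp_preimage_emb
    (measurableEmbedding_addLeft _) f]
  simp only [add_assoc]
  congr 2
  ext t
  simp only [Set.mem_preimage, Set.mem_Ico, zsmul_eq_mul]
  push_cast
  constructor <;> rintro ⟨h1, h2⟩ <;> constructor <;> linarith

theorem hasSum_integral_period {N : ℕ} (hN : 0 < N) (a : ℝ) {f : ℝ → ℂ} (hf : Integrable f) :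
    HasSum (fun n : ℤ => ∫ t in Set.Ico (0 : ℝ) N, f ((n : ℝ) * N + (a + t))) (∫ x, f x) := by
  have hN' : (0 : ℝ) < N := by exact_mod_cast hN
  have h := hasSum_integral_iUnion (μ := volume) (f := f) (fun _ => measurableSet_Ico)
    (Set.pairwise_disjoint_Ico_add_zsmul a (N : ℝ)) hf.integrableOn
  rw [iUnion_Ico_add_zsmul hN' a, setIntegral_univ] at h
  convert! h using 2 with n
  rw [← (measurePreserving_add_left volume ((n : ℝ) * N + a)).setIntegral_preimage_emb
    (measurableEmbedding_addLeft _) f]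
  simp only [add_assoc]
  congr 2
  ext t
  simp only [Set.mem_preimage, Set.mem_Ico, zsmul_eq_mul]
  push_cast
  constructor <;> rintro ⟨h1, h2⟩ <;> constructor <;> linarith

/-! ### The response of an operator to a delta train -/

/-- The inverse Fourier transform `∫ F(t, ν) e^{2πiνx} dν` of `F` in the second variable. -/
noncomputable def partialInverse (F : ℝ × ℝ → ℂ) (t x : ℝ) : ℂ :=
  ∫ ν, F (t, ν) * (𝐞 (ν * x) : ℂ)

/-- The response to the delta train at `nN + a` of the operator with spreading function `F`, if `F`
is supported in `[0, N) × ℝ`. -/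
noncomputable def trainResponse (N : ℕ) (F : ℝ × ℝ → ℂ) (a x : ℝ) : ℂ :=
  partialInverse F (N * Int.fract ((x - a) / N)) x

/-- The fractional part in `trainResponse` recovers `t` from `nN + a + t`, since `t/N ∈ [0,1)`. -/
theorem trainResponse_apply {N : ℕ} (F : ℝ × ℝ → ℂ) (a : ℝ) (n : ℤ) {t : ℝ}
    (ht : t ∈ Set.Ico (0 : ℝ) N) :
    trainResponse N F a ((n : ℝ) * N + (a + t)) =
      partialInverse F t ((n : ℝ) * N + (a + t)) := by
  have hN' : (0 : ℝ) < N := ht.1.trans_lt ht.2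
  have h : ((n : ℝ) * N + (a + t) - a) / N = t / N + n := by field_simp; ring
  have h2 : Int.fract (t / N) = t / N :=
    Int.fract_eq_self.2 ⟨div_nonneg ht.1 hN'.le, (div_lt_one hN').2 ht.2⟩
  rw [trainResponse, h, Int.fract_add_intCast, h2, mul_div_cancel₀ _ hN'.ne']

theorem measurable_partialInverse {F : ℝ × ℝ → ℂ} (hF : Measurable F) :
    Measurable fun z : ℝ × ℝ => partialInverse F z.1 z.2 := by
  refine StronglyMeasurable.measurable (StronglyMeasurable.integral_prod_right'
    (f := fun w : (ℝ × ℝ) × ℝ => F (w.1.1, w.2) * (𝐞 (w.2 * w.1.2) : ℂ)) ?_)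
  refine StronglyMeasurable.mul (Measurable.stronglyMeasurable (by fun_prop)) ?_
  exact Continuous.stronglyMeasurable (by fun_prop)

theorem measurable_trainResponse {F : ℝ × ℝ → ℂ} (hF : Measurable F) (N : ℕ) (a : ℝ) :
    Measurable (trainResponse N F a) :=
  (measurable_partialInverse hF).comp (g := fun z : ℝ × ℝ => partialInverse F z.1 z.2)
    (f := fun x : ℝ => ((N : ℝ) * Int.fract ((x - a) / N), x)) (by fun_prop)

theorem lintegral_enorm_sq_trainResponse {N : ℕ} (hN : 0 < N) {F : ℝ × ℝ → ℂ} (hF : Measurable F)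
    (a : ℝ) :
    ∫⁻ x, ‖trainResponse N F a x‖ₑ ^ 2 = ∫⁻ t in Set.Ico (0 : ℝ) N,
      ∑' n : ℤ, ‖∫ ν, F (t, ν) * (𝐞 (ν * ((n : ℝ) * N + (a + t))) : ℂ)‖ₑ ^ 2 := by
  rw [lintegral_eq_tsum_period hN a, lintegral_tsum]
  · refine tsum_congr fun n => setLIntegral_congr_fun measurableSet_Ico fun t ht => ?_
    simp only [trainResponse_apply F a n ht]
    rfl
  · intro n
    refine Measurable.aemeasurable (Measurable.pow_const (Measurable.enorm ?_) 2)
    exact (measurable_partialInverse hF).comp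
      (f := fun t : ℝ => (t, (n : ℝ) * N + (a + t))) (by fun_prop)

/-- The total energy of the responses to the delta trains is comparable to that of `F`. -/
theorem exists_trainResponse_bounds {M N : ℕ} (hN : 0 < N) {α : Fin (M * N) → ℝ}
    (hα : Function.Injective α) (hαN : ∀ j, α j ∈ Set.Ico (0 : ℝ) N) :
    ∃ c C : NNReal, 0 < c ∧ 0 < C ∧ ∀ F : ℝ × ℝ → ℂ, Measurable F → Integrable F → MemLp F 2 →
      (∀ z, z ∉ Set.Ico (0 : ℝ) N ×ˢ Set.Ioc (-(M : ℝ) / 2) (M / 2) → F z = 0) →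
      c * ∫⁻ z, ‖F z‖ₑ ^ 2 ≤ ∑ j, ∫⁻ x, ‖trainResponse N F (α j) x‖ₑ ^ 2 ∧
      ∑ j, ∫⁻ x, ‖trainResponse N F (α j) x‖ₑ ^ 2 ≤ C * ∫⁻ z, ‖F z‖ₑ ^ 2 := by
  obtain ⟨c, C, hc, hC, h⟩ := exists_sampling_bounds hN hα hαN
  refine ⟨c, C, hc, hC, fun F hm h1 h2 hF => ?_⟩
  have hm2 : Measurable fun z : ℝ × ℝ => ‖F z‖ₑ ^ 2 := hm.enorm.pow_const 2
  have htotal : ∫⁻ z, ‖F z‖ₑ ^ 2 = ∫⁻ t in Set.Ico (0 : ℝ) N, ∫⁻ ν, ‖F (t, ν)‖ₑ ^ 2 := by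
    refine (lintegral_prod _ hm2.aemeasurable).trans ?_
    refine (setLIntegral_eq_of_support_subset ?_).symm
    intro t ht
    by_contra ht'
    refine ht ?_
    have : ∀ ν, F (t, ν) = 0 := fun ν => hF _ fun hz => ht' hz.1
    simp [this]
  have hsamp : ∑ j, ∫⁻ x, ‖trainResponse N F (α j) x‖ₑ ^ 2 = ∫⁻ t in Set.Ico (0 : ℝ) N,
      ∑ j, ∑' n : ℤ, ‖∫ ν, F (t, ν) * (𝐞 (ν * ((n : ℝ) * N + (α j + t))) : ℂ)‖ₑ ^ 2 := by
    rw [lintegral_finsetSum]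
    · exact Finset.sum_congr rfl fun j _ => lintegral_enorm_sq_trainResponse hN hm (α j)
    · intro j _
      refine Measurable.tsum fun n => Measurable.pow_const (Measurable.enorm ?_) 2
      exact (measurable_partialInverse hm).comp
        (f := fun t : ℝ => (t, (n : ℝ) * N + (α j + t))) (by fun_prop)
  have hslice : ∀ᵐ t : ℝ, Integrable (fun ν => F (t, ν)) ∧ MemLp (fun ν => F (t, ν)) 2 := by
    have hsq : ∀ᵐ t : ℝ, Integrable (fun ν => ‖F (t, ν)‖ ^ 2) :=
      Integrable.prod_right_ae ((memLp_two_iff_integrable_sq_norm h2.1).1 h2)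
    filter_upwards [Integrable.prod_right_ae h1, hsq] with t ht1 ht2
    exact ⟨ht1, (memLp_two_iff_integrable_sq_norm ht1.1).2 ht2⟩
  -- Here `t` both selects the slice and shifts the sampling points; uniformity in the shift yields
  -- constants valid for almost every `t`.
  have hbd : ∀ᵐ t : ℝ ∂(volume.restrict (Set.Ico (0 : ℝ) N)), _ := ae_restrict_of_ae
    (hslice.mono fun t ht => h (fun ν => F (t, ν)) (hm.comp measurable_prodMk_left) ht.1 ht.2
      (fun ν hν => hF _ fun hz => hν hz.2) t)
  have hm3 : Measurable fun t : ℝ => ∫⁻ ν, ‖F (t, ν)‖ₑ ^ 2 := hm2.lintegral_prod_right'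
  rw [hsamp, htotal, ← lintegral_const_mul _ hm3, ← lintegral_const_mul _ hm3]
  exact ⟨lintegral_mono_ae (hbd.mono fun t ht => ht.1),
    lintegral_mono_ae (hbd.mono fun t ht => ht.2)⟩

/-- The weak identity between the response to a delta train and the spreading function. -/
theorem integral_trainResponse_mul {N : ℕ} (hN : 0 < N) {F : ℝ × ℝ → ℂ} (h1 : Integrable F)
    (hF : ∀ z : ℝ × ℝ, z.1 ∉ Set.Ico (0 : ℝ) N → F z = 0) (a : ℝ) (g : 𝓢(ℝ, ℂ))
    (hg : Integrable fun x => trainResponse N F a x * g x) :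
    Integrable (fun z : ℝ × ℝ => F z * modulation z.2 (translation z.1 (deltaTrain N a)) g) ∧
    ∫ x, trainResponse N F a x * g x =
      ∫ z : ℝ × ℝ, F z * modulation z.2 (translation z.1 (deltaTrain N a)) g := by
  set d : ℤ → ℝ × ℝ → ℂ := fun n z =>
    (𝐞 (z.2 * ((n : ℝ) * N + (a + z.1))) : ℂ) * g ((n : ℝ) * N + (a + z.1)) with hd
  have hdc : ∀ n, Continuous (d n) := fun n => by
    have := g.continuous
    fun_prop
  set B : ℝ := 4 * decaySeminorm g * (1 + (|a| + N)) ^ 2 with hB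
  have hFd : ∀ n z, ‖F z * d n z‖ ≤ B * ((1 + |(n : ℝ)|) ^ 2)⁻¹ * ‖F z‖ := by
    intro n z
    by_cases hz : z.1 ∈ Set.Ico (0 : ℝ) N
    · rw [norm_mul, mul_comm]
      gcongr
      rw [hd, norm_mul, norm_character, one_mul, hB]
      refine (norm_lattice_le hN g n _).trans ?_
      have : |a + z.1| ≤ |a| + N := (abs_add_le _ _).trans (by
        rw [abs_of_nonneg hz.1]; linarith [hz.2])
      gcongr
    · simp [hF z hz]
  have hint : ∀ n, Integrable fun z => F z * d n z := fun n =>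
    (h1.norm.const_mul _).mono' (h1.1.mul (hdc n).aestronglyMeasurable)
      (Filter.Eventually.of_forall (hFd n))
  have hbs : Summable fun n : ℤ => B * ((1 + |(n : ℝ)|) ^ 2)⁻¹ :=
    summable_inv_one_add_abs_sq.mul_left _
  have hD : ∀ z : ℝ × ℝ, modulation z.2 (translation z.1 (deltaTrain N a)) g = ∑' n, d n z :=
    fun z => modulation_translation_deltaTrain hN a z.1 z.2 g
  have hds : ∀ z, Summable fun n => d n z := fun z =>
    Summable.of_norm (by
      simpa [hd, norm_mul, norm_character] using (summable_lattice hN g (a + z.1)).norm)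
  have hDm : StronglyMeasurable fun z => ∑' n, d n z :=
    stronglyMeasurable_of_tendsto Filter.atTop
      (f := fun (s : Finset ℤ) z => ∑ n ∈ s, d n z)
      (fun s => (continuous_finsetSum s fun n _ => hdc n).stronglyMeasurable)
      (tendsto_pi_nhds.2 fun z => (hds z).hasSum)
  have hnorm : Summable fun n => ∫ z, ‖F z * d n z‖ := by
    refine Summable.of_nonneg_of_le (fun n => integral_nonneg fun z => norm_nonneg _)
      (fun n => ?_) (hbs.mul_right (∫ z, ‖F z‖))
    rw [← integral_const_mul]
    exact integral_mono (hint n).norm (h1.norm.const_mul _) (hFd n)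
  have hsum := hasSum_integral_of_summable_integral_norm hint hnorm
  have hterm : ∀ n : ℤ, ∫ z, F z * d n z = ∫ t in Set.Ico (0 : ℝ) N,
      trainResponse N F a ((n : ℝ) * N + (a + t)) * g ((n : ℝ) * N + (a + t)) := by
    intro n
    have e1 : ∫ z, F z * d n z = ∫ t, partialInverse F t ((n : ℝ) * N + (a + t)) *
        g ((n : ℝ) * N + (a + t)) := by
      refine (integral_prod _ (hint n)).trans (integral_congr_ae
        (Filter.Eventually.of_forall fun t => ?_))
      simp only [partialInverse, hd, ← mul_assoc]
      rw [integral_mul_const]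
    rw [e1, ← setIntegral_eq_integral_of_forall_compl_eq_zero (s := Set.Ico (0 : ℝ) N)]
    · exact setIntegral_congr_fun measurableSet_Ico fun t ht => by
        simp only [trainResponse_apply F a n ht]
    · intro t ht
      have : ∀ ν, F (t, ν) = 0 := fun ν => hF _ ht
      simp [partialInverse, this]
  simp only [hD]
  refine ⟨(h1.norm.const_mul (∑' n : ℤ, B * ((1 + |(n : ℝ)|) ^ 2)⁻¹)).mono'
    (h1.1.mul hDm.aestronglyMeasurable) (Filter.Eventually.of_forall fun z => ?_), ?_⟩
  · rw [← tsum_mul_left, ← tsum_mul_right]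
    exact tsum_of_norm_bounded (hbs.mul_right _).hasSum fun n => hFd n z
  -- The double integral, expanded over deltas, and the integral of the response, cut into periods,
  -- are sums of the same series.
  · simp only [hterm, tsum_mul_left] at hsum
    exact (hasSum_integral_period hN a hg).unique hsum

/-! ### From integrals in `[0,∞]` to `L²` norms -/

theorem memLp_two_of_lintegral_lt_top {X : Type*} [MeasureSpace X] {f : X → ℂ}
    (hf : AEStronglyMeasurable f) (h : ∫⁻ x, ‖f x‖ₑ ^ 2 < ⊤) : MemLp f 2 := by
  refine ⟨hf, ?_⟩
  have := eLpNorm_nnreal_pow_eq_lintegral (f := f) (μ := volume) (p := 2) (by norm_num)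
  simp only [NNReal.coe_ofNat, ENNReal.coe_ofNat, ENNReal.rpow_ofNat] at this
  rw [← this] at h
  by_contra hcon
  rw [not_lt, top_le_iff] at hcon
  simp [hcon] at h

theorem enorm_sq_toLp {X : Type*} [MeasureSpace X] {f : X → ℂ} (hf : MemLp f 2) :
    ‖(hf.toLp : L2 X)‖ₑ ^ 2 = ∫⁻ x, ‖f x‖ₑ ^ 2 := by
  rw [enorm_sq_L2]
  exact lintegral_congr_ae (by filter_upwards [hf.coeFn_toLp] with x hx; rw [hx])

theorem norm_sq_bounds_of_enorm {ι : Type*} [Fintype ι] {E E' : Type*} [NormedAddCommGroup E]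
    [NormedAddCommGroup E'] {η : E} {u : ι → E'} {c C : NNReal}
    (h1 : (c : ENNReal) * ‖η‖ₑ ^ 2 ≤ ∑ j, ‖u j‖ₑ ^ 2)
    (h2 : ∑ j, ‖u j‖ₑ ^ 2 ≤ (C : ENNReal) * ‖η‖ₑ ^ 2) :
    (c : ℝ) * ‖η‖ ^ 2 ≤ ∑ j, ‖u j‖ ^ 2 ∧ ∑ j, ‖u j‖ ^ 2 ≤ (C : ℝ) * ‖η‖ ^ 2 := by
  simp only [enorm_eq_nnnorm] at h1 h2
  norm_cast at h1 h2
  simp only [← coe_nnnorm]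
  exact ⟨by exact_mod_cast h1, by exact_mod_cast h2⟩

end OperatorSampling

/-! ### The sampling theorem for operators -/

theorem theorem5p4 (M N : ℕ) (α : Fin (M * N) → ℝ) (hα : StrictMono α)
    (hα0 : ∀ j, 0 ≤ α j) (hαN : ∀ j, α j < N) :
    (∀ j, Summable (deltaTerm N (α j))) ∧
    ∃ c C : ℝ, 0 < c ∧ 0 < C ∧
      ∀ H ∈ OPW (Set.Icc (0 : ℝ) N ×ˢ Set.Icc (-(M : ℝ) / 2) ((M : ℝ) / 2)),
        ∃ u : Fin (M * N) → L2 ℝ,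
          (∀ j, IsImage H (deltaTrain N (α j)) (u j)) ∧
          c * H.hsNorm ^ 2 ≤ ∑ j, ‖u j‖ ^ 2 ∧
          ∑ j, ‖u j‖ ^ 2 ≤ C * H.hsNorm ^ 2 := by
  rcases Nat.eq_zero_or_pos N with rfl | hN
  -- For `N = 0` there are no sampling points and the rectangle is a null set, so `‖H‖_HS = 0` and
  -- any positive constants serve.
  · refine ⟨fun j => j.elim0, 1, 1, one_pos, one_pos, fun H hH => ⟨fun j => j.elim0,
      fun j => j.elim0, ?_⟩⟩
    have hnull : volume (Set.Icc (0 : ℝ) (0 : ℕ) ×ˢ Set.Icc (-(M : ℝ) / 2) ((M : ℝ) / 2)) = 0 := by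
      rw [Measure.volume_eq_prod, Measure.prod_prod]
      simp
    have h0 : H.spreading = 0 := by
      rw [Lp.eq_zero_iff_ae_eq_zero]
      filter_upwards [hH, measure_eq_zero_iff_ae_notMem.1 hnull] with z h1 h2 using h1 h2
    have h : H.hsNorm = 0 := by rw [← H.norm_spreading, h0, norm_zero]
    have e : ∀ f : Fin (M * 0) → ℝ, ∑ j, f j = 0 := fun f => rfl
    rw [e, h]
    simp
  refine ⟨fun j => summable_deltaTerm hN _, ?_⟩
  obtain ⟨c, C, hc, hC, hbd⟩ := exists_trainResponse_bounds hN hα.injective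
    fun j => ⟨hα0 j, hαN j⟩
  refine ⟨c, C, by exact_mod_cast hc, by exact_mod_cast hC, fun H hH => ?_⟩
  -- The half-open rectangle differs from the closed one by a null set, but its sides are tiled
  -- exactly by periods and by folding intervals.
  set S : Set (ℝ × ℝ) := Set.Ico (0 : ℝ) N ×ˢ Set.Ioc (-(M : ℝ) / 2) (M / 2) with hS
  have hSm : MeasurableSet S := measurableSet_Ico.prod measurableSet_Ioc
  have hSae : (S : Set (ℝ × ℝ)) =ᵐ[volume]
      (Set.Icc (0 : ℝ) N ×ˢ Set.Icc (-(M : ℝ) / 2) ((M : ℝ) / 2) : Set (ℝ × ℝ)) :=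
    Measure.set_prod_ae_eq Ico_ae_eq_Icc Ioc_ae_eq_Icc
  have hSfin : volume S ≠ ⊤ := by
    rw [measure_congr hSae]
    exact (isCompact_Icc.prod isCompact_Icc).measure_ne_top
  -- This representative of the spreading function vanishes everywhere off `S`, so the support
  -- conditions hold for every slice. Being in `L²` on a set of finite measure, it is also
  -- integrable.
  set F : ℝ × ℝ → ℂ := S.indicator H.spreading with hF
  have hFm : Measurable F := (Lp.stronglyMeasurable H.spreading).measurable.indicator hSm
  have hFη : F =ᵐ[volume] H.spreading := by
    filter_upwards [hH, hSae.mem_iff] with z h1 h2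
    by_cases hz : z ∈ S
    · rw [hF, Set.indicator_of_mem hz]
    · rw [hF, Set.indicator_of_notMem hz]
      exact (h1 (mt h2.2 hz)).symm
  have hF2 : MemLp F 2 := (Lp.memLp H.spreading).indicator hSm
  have hF1 : Integrable F := by
    have : Fact (volume S < ⊤) := ⟨hSfin.lt_top⟩
    rw [hF, integrable_indicator_iff hSm]
    exact ((Lp.memLp H.spreading).restrict S).integrable (by norm_num)
  have hF0 : ∀ z, z ∉ S → F z = 0 := fun z hz => Set.indicator_of_notMem hz _
  obtain ⟨hlow, hup⟩ := hbd F hFm hF1 hF2 hF0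
  have hnorm : ∫⁻ z, ‖F z‖ₑ ^ 2 = ‖H.spreading‖ₑ ^ 2 := by
    rw [enorm_sq_L2]
    exact lintegral_congr_ae (by filter_upwards [hFη] with z hz; rw [hz])
  rw [hnorm] at hlow hup
  have hfin : ∀ j, ∫⁻ x, ‖trainResponse N F (α j) x‖ₑ ^ 2 < ⊤ := fun j =>
    ((Finset.single_le_sum (f := fun j => ∫⁻ x, ‖trainResponse N F (α j) x‖ₑ ^ 2)
      (fun _ _ => zero_le) (Finset.mem_univ j)).trans hup).trans_lt
      (ENNReal.mul_lt_top ENNReal.coe_lt_top (ENNReal.pow_lt_top enorm_lt_top))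
  have hu : ∀ j, MemLp (trainResponse N F (α j)) 2 := fun j =>
    memLp_two_of_lintegral_lt_top (measurable_trainResponse hFm N (α j)).aestronglyMeasurable
      (hfin j)
  refine ⟨fun j => (hu j).toLp, fun j g => ?_, ?_⟩
  · obtain ⟨hi, he⟩ := integral_trainResponse_mul hN hF1
      (fun z hz => hF0 z fun h => hz h.1) (α j) g ((hu j).integrable_mul (g.memLp 2))
    have hae : (fun z : ℝ × ℝ => F z * modulation z.2 (translation z.1 (deltaTrain N (α j))) g)
        =ᵐ[volume] fun z : ℝ × ℝ =>
          H.spreading z * modulation z.2 (translation z.1 (deltaTrain N (α j))) g := by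
      filter_upwards [hFη] with z hz
      rw [hz]
    refine ⟨hi.congr hae, ?_⟩
    rw [← integral_congr_ae hae, ← he]
    exact integral_congr_ae (by filter_upwards [(hu j).coeFn_toLp] with x hx; rw [hx])
  · rw [← H.norm_spreading]
    refine norm_sq_bounds_of_enorm ?_ ?_
    · simpa only [enorm_sq_toLp] using hlow
    · simpa only [enorm_sq_toLp] using hup
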